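/- **Corollary (Skew Giambelli formulas for flagged supersymmetric Schur functions).** *Setting.* Let $\mathbf y=(y_i)_{i\in\mathbb Z}$, $\mathbf z=(z_i)_{i\in\mathbb Z}$ be variables (or arbitrary elements of a commutative ring). For integers $p,q$ write $\mathbf y_{p,q}=(y_i)_{p\le i\le q}$ (empty if $p>q$), and similarly for $\mathbf z$. For finite families put $e_n(\mathbf x/\mathbf w)=\sum_{i=0}^n(-1)^{n-i}e_i(\mathbf x)h_{n-i}(\mathbf w)$ for $n\ge0$, with $e_i,h_i$ the usual elementary and complete homogeneous symmetric functions, and $e_n(\mathbf x/\mathbf w)=0$ for $n<0$. A skew r-shape $(\lambda/\mu,r)$ is a skew shape $\lambda/\mu$ with an integer $r$; the position in row $i$, column $j$ has content $c(i,j)=j-i+r-1+\lambda'_1$, so the position $(\lambda'_1,1)$ has content $r$; the usual contents are given by $r=1-\lambda'_1$. Column flags for it are integer vectors $\mathbf a,\mathbf b$ with $a_i-a_{i+1}\le\mu'_i-\mu'_{i+1}+1$ and $b_i-b_{i+1}\le\lambda'_i-\lambda'_{i+1}+1$ whenever $\mu'_i<\lambda'_{i+1}$. Put $a'_j=a_j+c(\mu'_j+1,j)$,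 $b'_j=b_j+c(\lambda'_j,j)$. The flagged supersymmetric Schur function is $$\mathsf S^{\mathbf a,\mathbf b}_{\lambda/\mu}(\mathbf y/\mathbf z)=\det\bigl[e_{\lambda'_i-i-\mu'_j+j}(\mathbf y_{a_j,b_i}/\mathbf z_{a'_j,b'_i})\bigr]_{1\le i,j\le n},\qquad n\ge\lambda_1,$$ which does not depend on the choice of $n$; in particular $\mathsf S_\varnothing=1$. *Induced ribbon flags.* Let $\theta$ be a ribbon with prescribed (shifted) contents. For its $r$-th column from the left, let $m_r$ be the leftmost cell of $\lambda/\mu$ whose content equals that of the top cell of that column, and $M_r$ the rightmost cell of $\lambda/\mu$ whose content equals that of the bottom cell of that column. The flags on $\theta$ induced by $\mathbf a,\mathbf b$ are $$a^\theta_r=a_{\mathrm{col}(m_r)}-(\mu'_{\mathrm{col}(m_r)}+1)+\mathrm{row}(m_r),\qquad b^\theta_r=b_{\mathrm{col}(M_r)}-\lambda'_{\mathrm{col}(M_r)}+\mathrm{row}(M_r).$$ (If $\lambda/\mu$ has no cell of the required content, which can happen only if $\lambda/\mu$ is disconnected or has an empty row or column, the position $(1,1)$ is used in its place; the choice does not affect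 the formula below.) *Statement.* Let $(\lambda/\mu,r)$ be a skew r-shape with column flags $\mathbf a,\mathbf b$, and let $\lambda=(u_1,\dots,u_k\,|\,v_1,\dots,v_k)$ and $\mu=(c_1,\dots,c_\ell\,|\,d_1,\dots,d_\ell)$ in Frobenius notation, so that $u_i=\lambda_i-i$, $v_i=\lambda'_i-i$ for $i\le k$ and $c_i=\mu_i-i$, $d_i=\mu'_i-i$ for $i\le\ell$. Let $\kappa=c(1,1)=r-1+\lambda'_1$. Then $$\mathsf S^{\mathbf a,\mathbf b}_{\lambda/\mu}(\mathbf y/\mathbf z)=(-1)^\ell\det\begin{bmatrix}\bigl[H_{ij}\bigr]_{i,j\in[k]}&\bigl[V_{ij}\bigr]_{i\in[k],\,j\in[\ell]}\\[4pt]\bigl[W_{ij}\bigr]_{i\in[\ell],\,j\in[k]}&\mathbf 0\end{bmatrix},$$ where * $H_{ij}$ is the flagged supersymmetric Schur function of the hook $(u_j\,|\,v_i)$, with contents from $\kappa-v_i$ to $\kappa+u_j$; * $V_{ij}$ is that of the vertical strip $1^{v_i-d_j}$, with contents from $\kappa-v_i$ to $\kappa-d_j-1$; * $W_{ij}$ is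 that of the horizontal strip $(u_j-c_i)$, with contents from $\kappa+c_i+1$ to $\kappa+u_j$, each taken in $\mathbf y/\mathbf z$ with its flags induced by $\mathbf a,\mathbf b$. Here $V_{ij}=1$ if $v_i=d_j$ and $V_{ij}=0$ if $v_i<d_j$; likewise $W_{ij}=1$ if $u_j=c_i$ and $W_{ij}=0$ if $u_j<c_i$. -/

import Mathlib

namespace FlaggedSchur

/-! Rows and columns are numbered from `0`, as in Mathlib's `YoungDiagram`; so
`ν.rowLen i` is the part `ν_{i+1}` and `ν.colLen j` is the conjugate part `ν'_{j+1}`. -/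

section Supersymmetric

variable {R : Type*} [CommRing R]

/-- The elementary symmetric function `e_k` of the variables `x i`, `i ∈ s`. -/
def elemSymm (x : ℤ → R) (s : Finset ℤ) (k : ℕ) : R :=
  (s.val.map x).esymm k

/-- The complete homogeneous symmetric function `h_k` of the variables `x i`, `i ∈ s`:
the sum over all multisets of size `k` in `s`. -/
def complSymm (x : ℤ → R) (s : Finset ℤ) (k : ℕ) : R :=
  ∑ m ∈ s.sym k, ((m : Multiset ℤ).map x).prod

/-- The elementary supersymmetric function
`e_n(y_s / z_t) = ∑_{i=0}^n (-1)^{n-i} e_i(y_s) h_{n-i}(z_t)`, which is `0` for `n < 0`. -/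
def superElem (y z : ℤ → R) (s t : Finset ℤ) : ℤ → R
  | Int.ofNat n =>
      ∑ i ∈ Finset.range (n + 1), (-1) ^ (n - i) * elemSymm y s i * complSymm z t (n - i)
  | Int.negSucc _ => 0

end Supersymmetric

/-- A skew r-shape: a skew shape `outer / inner` together with its root content, the content of
its bottom-left cell. -/
structure RShape where
  outer : YoungDiagram
  inner : YoungDiagram
  inner_le : inner ≤ outer
  root : ℤ

namespace RShape

/-- The cells of the skew diagram. -/
def cells (s : RShape) : Finset (ℕ × ℕ) := s.outer.cells \ s.inner.cells

/-- The (shifted) content `j - i + r - 1 + λ'_1` of the position in row `i`, column `j`. -/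
def content (s : RShape) (i j : ℤ) : ℤ := j - i + s.root - 1 + s.outer.colLen 0

/-- The content of the top cell of column `j`. -/
def topContent (s : RShape) (j : ℕ) : ℤ := s.content (s.inner.colLen j) j

/-- The content of the bottom cell of column `j`. -/
def botContent (s : RShape) (j : ℕ) : ℤ := s.content (s.outer.colLen j - 1) j

/-- The straight r-shape `(ν, r)`. -/
def straight (ν : YoungDiagram) (r : ℤ) : RShape := ⟨ν, ⊥, bot_le, r⟩

/-- `a, b` are column flags for the r-shape. Only the entries in columns below `λ_1` matter. -/
def IsColumnFlags (s : RShape) (a b : ℕ → ℤ) : Prop :=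
  ∀ i : ℕ, s.inner.colLen i < s.outer.colLen (i + 1) →
    a i - a (i + 1) ≤ (s.inner.colLen i : ℤ) - s.inner.colLen (i + 1) + 1 ∧
    b i - b (i + 1) ≤ (s.outer.colLen i : ℤ) - s.outer.colLen (i + 1) + 1

/-- The conjugate flag `a'_j = a_j + c(top cell of column j)`. -/
def conjA (s : RShape) (a : ℕ → ℤ) (j : ℕ) : ℤ := a j + s.topContent j

/-- The conjugate flag `b'_j = b_j + c(bottom cell of column j)`. -/
def conjB (s : RShape) (b : ℕ → ℤ) (j : ℕ) : ℤ := b j + s.botContent j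

variable {R : Type*} [CommRing R]

/-- The `n × n` matrix `[e_{λ'_i - i - μ'_j + j}(y_{[a_j, b_i]} / z_{[a'_j, b'_i]})]`. -/
noncomputable def schurMatrix (s : RShape) (a b : ℕ → ℤ) (y z : ℤ → R) (n : ℕ) : Matrix (Fin n) (Fin n) R :=
  Matrix.of fun i j =>
    superElem y z (Finset.Icc (a j) (b i)) (Finset.Icc (s.conjA a j) (s.conjB b i))
      ((s.outer.colLen i : ℤ) - (i : ℕ) - s.inner.colLen j + (j : ℕ))

/-- The flagged supersymmetric Schur function `S^{a,b}_{λ/μ}(y / z)`: the determinant of the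
matrix above of size `λ_1` (see `det_schurMatrix` for the sizes `n ≥ λ_1`). -/
noncomputable def schur (s : RShape) (a b : ℕ → ℤ) (y z : ℤ → R) : R :=
  (s.schurMatrix a b y z (s.outer.rowLen 0)).det

theorem colLen_eq_zero {ν : YoungDiagram} {n : ℕ} (h : ν.rowLen 0 ≤ n) : ν.colLen n = 0 := by
  by_contra hne
  have h1 : (0, n) ∈ ν := YoungDiagram.mem_iff_lt_colLen.2 (Nat.pos_of_ne_zero hne)
  exact absurd (YoungDiagram.mem_iff_lt_rowLen.1 h1) (not_lt.2 h)

/-- The determinant does not depend on its size `n ≥ λ_1`. -/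
theorem det_schurMatrix (s : RShape) (a b : ℕ → ℤ) (y z : ℤ → R) {n : ℕ}
    (hn : s.outer.rowLen 0 ≤ n) : (s.schurMatrix a b y z n).det = s.schur a b y z := by
  induction n, hn using Nat.le_induction with
  | base => rfl
  | succ n hn ih =>
    have ho : s.outer.colLen n = 0 := colLen_eq_zero hn
    have hi : s.inner.colLen n = 0 := by
      by_contra hne
      have h1 : (0, n) ∈ s.inner := YoungDiagram.mem_iff_lt_colLen.2 (Nat.pos_of_ne_zero hne)
      have h2 := YoungDiagram.mem_iff_lt_colLen.1 (s.inner_le h1)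
      omega
    rw [← ih, Matrix.det_succ_row _ (Fin.last n), Finset.sum_eq_single (Fin.last n)]
    · have h1 : s.schurMatrix a b y z (n + 1) (Fin.last n) (Fin.last n) = 1 := by
        simp only [schurMatrix, Matrix.of_apply, Fin.val_last, ho, hi]
        have h0 : ((0 : ℕ) : ℤ) - (n : ℤ) - ((0 : ℕ) : ℤ) + (n : ℤ) = Int.ofNat 0 := by simp
        rw [h0]
        simp only [superElem, elemSymm, complSymm, zero_add, Finset.sum_range_one, Multiset.esymm]
        simp
        rfl
      rw [h1, Fin.succAbove_last, Even.neg_one_pow ⟨n, by simp⟩, one_mul, one_mul]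
      rfl
    · intro j _ hj
      have hjn : (j : ℕ) < n := by
        have h1 := j.isLt
        have h2 : (j : ℕ) ≠ n := fun h => hj (Fin.ext h)
        omega
      have h1 : s.schurMatrix a b y z (n + 1) (Fin.last n) j = 0 := by
        simp only [schurMatrix, Matrix.of_apply, Fin.val_last, ho]
        obtain ⟨m, hm⟩ := Int.eq_negSucc_of_lt_zero
          (show ((0 : ℕ) : ℤ) - (n : ℤ) - (s.inner.colLen j : ℤ) + ((j : ℕ) : ℤ) < 0 by
            push_cast; omega)
        rw [hm]
        rfl
      rw [h1]
      simp
    · simp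

/-- Row of the leftmost (equivalently, topmost) cell of content `c`. -/
noncomputable def minRow (s : RShape) (c : ℤ) : ℕ :=
  sInf {i | ∃ j, (i, j) ∈ s.cells ∧ s.content i j = c}

/-- Column of the leftmost cell of content `c`. -/
noncomputable def minCol (s : RShape) (c : ℤ) : ℕ :=
  sInf {j | ∃ i, (i, j) ∈ s.cells ∧ s.content i j = c}

/-- Row of the rightmost (equivalently, bottommost) cell of content `c`. -/
noncomputable def maxRow (s : RShape) (c : ℤ) : ℕ :=
  sSup {i | ∃ j, (i, j) ∈ s.cells ∧ s.content i j = c}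

/-- Column of the rightmost cell of content `c`. -/
noncomputable def maxCol (s : RShape) (c : ℤ) : ℕ :=
  sSup {j | ∃ i, (i, j) ∈ s.cells ∧ s.content i j = c}

/-- Whenever the diagram has a cell of content `c`, the position `(minRow c, minCol c)` is the
leftmost such cell. -/
theorem min_spec (s : RShape) {c : ℤ} (h : ∃ i j : ℕ, (i, j) ∈ s.cells ∧ s.content i j = c) :
    ((s.minRow c, s.minCol c) ∈ s.cells ∧ s.content (s.minRow c) (s.minCol c) = c) ∧
      ∀ i j : ℕ, (i, j) ∈ s.cells → s.content i j = c → s.minCol c ≤ j := by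
  obtain ⟨i, j, hij⟩ := h
  obtain ⟨j₁, h₁, hc₁⟩ : s.minRow c ∈ {i | ∃ j, (i, j) ∈ s.cells ∧ s.content i j = c} :=
    Nat.sInf_mem ⟨i, j, hij⟩
  obtain ⟨i₂, h₂, hc₂⟩ : s.minCol c ∈ {j | ∃ i, (i, j) ∈ s.cells ∧ s.content i j = c} :=
    Nat.sInf_mem ⟨j, i, hij⟩
  have hr : s.minRow c ≤ i₂ := Nat.sInf_le ⟨_, h₂, hc₂⟩
  have hl : s.minCol c ≤ j₁ := Nat.sInf_le ⟨_, h₁, hc₁⟩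
  have he : s.minRow c = i₂ := by
    simp only [content] at hc₁ hc₂
    omega
  refine ⟨⟨he ▸ h₂, he ▸ hc₂⟩, fun i j h hc => Nat.sInf_le ⟨i, h, hc⟩⟩

/-- Whenever the diagram has a cell of content `c`, the position `(maxRow c, maxCol c)` is the
rightmost such cell. -/
theorem max_spec (s : RShape) {c : ℤ} (h : ∃ i j : ℕ, (i, j) ∈ s.cells ∧ s.content i j = c) :
    ((s.maxRow c, s.maxCol c) ∈ s.cells ∧ s.content (s.maxRow c) (s.maxCol c) = c) ∧
      ∀ i j : ℕ, (i, j) ∈ s.cells → s.content i j = c → j ≤ s.maxCol c := by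
  have hbr : BddAbove {i : ℕ | ∃ j : ℕ, (i, j) ∈ s.cells ∧ s.content i j = c} := by
    refine ((s.cells.image Prod.fst).finite_toSet.subset ?_).bddAbove
    rintro i ⟨j, hj, -⟩
    exact Finset.mem_coe.2 (Finset.mem_image.2 ⟨_, hj, rfl⟩)
  have hbc : BddAbove {j : ℕ | ∃ i : ℕ, (i, j) ∈ s.cells ∧ s.content i j = c} := by
    refine ((s.cells.image Prod.snd).finite_toSet.subset ?_).bddAbove
    rintro j ⟨i, hi, -⟩
    exact Finset.mem_coe.2 (Finset.mem_image.2 ⟨_, hi, rfl⟩)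
  obtain ⟨i, j, hij⟩ := h
  obtain ⟨j₁, h₁, hc₁⟩ : s.maxRow c ∈ {i | ∃ j, (i, j) ∈ s.cells ∧ s.content i j = c} :=
    Nat.sSup_mem ⟨i, j, hij⟩ hbr
  obtain ⟨i₂, h₂, hc₂⟩ : s.maxCol c ∈ {j | ∃ i, (i, j) ∈ s.cells ∧ s.content i j = c} :=
    Nat.sSup_mem ⟨j, i, hij⟩ hbc
  have hr : i₂ ≤ s.maxRow c := le_csSup hbr ⟨_, h₂, hc₂⟩
  have hl : j₁ ≤ s.maxCol c := le_csSup hbc ⟨_, h₁, hc₁⟩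
  have he : s.maxRow c = i₂ := by
    simp only [content] at hc₁ hc₂
    omega
  refine ⟨⟨he ▸ h₂, he ▸ hc₂⟩, fun i j h hc => le_csSup hbc ⟨i, h, hc⟩⟩

/-- The flag induced by `a` on a ribbon `θ` (as an r-shape). The vertical strips of the canonical
decomposition of `θ` are its columns. With `(i, j)` the leftmost cell of `s` whose content is that
of the top cell of column `r` of `θ`, the value is `a_j - (μ'_j + 1) + row`, where the row counted
from one is `i + 1`. -/
noncomputable def inducedA (s : RShape) (a : ℕ → ℤ) (θ : RShape) (r : ℕ) : ℤ :=
  a (s.minCol (θ.topContent r)) - ((s.inner.colLen (s.minCol (θ.topContent r)) : ℤ) + 1)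
    + ((s.minRow (θ.topContent r) : ℤ) + 1)

/-- The flag induced by `b` on a ribbon `θ`. With `(i, j)` the rightmost cell of `s` whose content
is that of the bottom cell of column `r` of `θ`, the value is `b_j - λ'_j + row`, where the row
counted from one is `i + 1`. -/
noncomputable def inducedB (s : RShape) (b : ℕ → ℤ) (θ : RShape) (r : ℕ) : ℤ :=
  b (s.maxCol (θ.botContent r)) - (s.outer.colLen (s.maxCol (θ.botContent r)) : ℤ)
    + ((s.maxRow (θ.botContent r) : ℤ) + 1)

/-- The flagged supersymmetric Schur function of the ribbon `θ` with the flags induced by the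
flags `a, b` of `s`. -/
noncomputable def ribbonSchur (s : RShape) (a b : ℕ → ℤ) (y z : ℤ → R) (θ : RShape) : R :=
  θ.schur (s.inducedA a θ) (s.inducedB b θ) y z

end RShape

/-! Frobenius notation. -/

/-- The number of diagonal cells. -/
def durfee (ν : YoungDiagram) : ℕ := (ν.cells.filter fun c => c.1 = c.2).card

/-- The number of cells to the right of the diagonal cell `(i, i)`. -/
def arm (ν : YoungDiagram) (i : ℕ) : ℕ := ν.rowLen i - (i + 1)

/-- The number of cells below the diagonal cell `(i, i)`. -/
def leg (ν : YoungDiagram) (i : ℕ) : ℕ := ν.colLen i - (i + 1)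

/-- The rectangle with `m` rows and `n` columns. -/
def rect (m n : ℕ) : YoungDiagram where
  cells := Finset.range m ×ˢ Finset.range n
  isLowerSet := by
    rintro ⟨i, j⟩ ⟨i', j'⟩ h hm
    simp only [Finset.coe_product, Finset.coe_range, Set.mem_prod, Set.mem_Iio] at hm ⊢
    exact ⟨lt_of_le_of_lt h.1 hm.1, lt_of_le_of_lt h.2 hm.2⟩

/-- The hook `(u | v)`: a corner cell, `u` cells to its right and `v` cells below it. -/
def hook (u v : ℕ) : YoungDiagram := rect 1 (u + 1) ⊔ rect (v + 1) 1

namespace RShape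

variable {R : Type*} [CommRing R]

/-- The hook `(u_j | v_i)`, with contents from `-v_i` to `u_j` relative to the content of the
position in the first row and first column. -/
def hookRibbon (s : RShape) (i j : ℕ) : RShape :=
  straight (hook (arm s.outer j) (leg s.outer i)) (s.content 0 0 - leg s.outer i)

/-- The vertical strip `1^{v_i - d_j}`, with relative contents from `-v_i` to `-d_j - 1`. -/
def vertRibbon (s : RShape) (i j : ℕ) : RShape :=
  straight (rect (leg s.outer i - leg s.inner j) 1) (s.content 0 0 - leg s.outer i)

/-- The horizontal strip of length `u_j - c_i`, with relative contents from `c_i + 1` to `u_j`. -/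
def horizRibbon (s : RShape) (i j : ℕ) : RShape :=
  straight (rect 1 (arm s.outer j - arm s.inner i)) (s.content 0 0 + arm s.inner i + 1)

/-- The entry of the hook `(u_j | v_i)`. -/
noncomputable def hookEntry (s : RShape) (a b : ℕ → ℤ) (y z : ℤ → R) (i j : ℕ) : R :=
  s.ribbonSchur a b y z (s.hookRibbon i j)

/-- The entry of `1^{v_i - d_j}`; it is `0` if `v_i < d_j`, when the strip is undefined
(and `1` if `v_i = d_j`, when the strip is empty). -/
noncomputable def vertEntry (s : RShape) (a b : ℕ → ℤ) (y z : ℤ → R) (i j : ℕ) : R :=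
  if leg s.inner j ≤ leg s.outer i then s.ribbonSchur a b y z (s.vertRibbon i j) else 0

/-- The entry of the horizontal strip `u_j - c_i`; it is `0` if `u_j < c_i`, when the strip is
undefined (and `1` if `u_j = c_i`, when the strip is empty). -/
noncomputable def horizEntry (s : RShape) (a b : ℕ → ℤ) (y z : ℤ → R) (i j : ℕ) : R :=
  if arm s.inner i ≤ arm s.outer j then s.ribbonSchur a b y z (s.horizRibbon i j) else 0

end RShape

end FlaggedSchur

/-! An induced flag depends on a column only through the content of its top or bottom cell. So there
is one function `kernel` of a bottom content B and a top content t such that every ribbon function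
here, and `schur` itself (`schur_eq_det_kernel`), is a determinant of values of `kernel`. It
vanishes for t + 1 < B and is 1 for t + 1 = B.

Put g(i, j) = `kernel`(κ + i + 1, κ + j), which is upper unitriangular. By Frobenius notation the
bottom contents are κ - v_i for i ≤ k, and otherwise κ + 1 plus the numbers not among the u_i; the
top contents are κ - d_j - 1 for j ≤ ℓ, and otherwise κ plus the numbers not among the c_j. Hence,
up to permutations σ of rows and τ of columns, the matrix of `schur` is g with k rows and ℓ columns
replaced, the new columns being zero outside the new rows.

Such a determinant collapses to a block determinant of size k + ℓ built from the inverse of g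
(`det_of_replaced`). That inverse consists of signed contiguous minors of g
(`unitriangular_mul_minors`), which are the horizontal strips; multiplying a replaced row into it
gives the hooks (`hookEntry_eq`). The remaining signs are those of σ and τ (`sign_frobeniusPerm`).
-/

namespace FlaggedSchur

/-! ### Inverses of unitriangular matrices, and determinants with replaced rows and columns. -/

section LinearAlgebra

open Matrix

variable {R : Type*} [CommRing R]

/-- The contiguous minor, of size `p`, with rows from `t` and columns from `t + 1`. -/
noncomputable def shiftedMinor (g : ℕ → ℕ → R) (t p : ℕ) : R :=
  (Matrix.of fun i j : Fin p => g (t + i) (t + 1 + j)).det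

/-- A matrix with first row `r` whose further rows are those of `g`. -/
def hessenberg (r : ℕ → R) (g : ℕ → ℕ → R) (m : ℕ) : Matrix (Fin (m + 1)) (Fin (m + 1)) R :=
  Matrix.of fun i j => Fin.cases (r j) (fun i' : Fin m => g i' j) i

/-- Expansion of a Hessenberg determinant along its first row. -/
theorem det_hessenberg (m : ℕ) (r : ℕ → R) (g : ℕ → ℕ → R) (h0 : ∀ i j, j < i → g i j = 0)
    (h1 : ∀ i, g i i = 1) :
    (hessenberg r g m).det =
      ∑ t ∈ Finset.range (m + 1), (-1) ^ t * r t * shiftedMinor g t (m - t) := by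
  induction m generalizing r g with
  | zero => simp [hessenberg, shiftedMinor]
  | succ m ih =>
    have hA : ((hessenberg r g (m + 1)).submatrix (Fin.succAbove 0) Fin.succ).det =
        shiftedMinor g 0 (m + 1) := by
      unfold shiftedMinor
      congr 1
      ext i j
      simp [hessenberg, add_comm]
    have hB : (hessenberg r g (m + 1)).submatrix (Fin.succAbove 1) Fin.succ =
        hessenberg (fun t => r (t + 1)) (fun i j => g (i + 1) (j + 1)) m := by
      ext i j
      refine Fin.cases ?_ (fun i => ?_) i
      · simp [hessenberg]
      · have : (Fin.succAbove (1 : Fin (m + 2)) i.succ) = i.succ.succ := by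
          rw [← Fin.succ_zero_eq_one, Fin.succ_succAbove_succ, Fin.zero_succAbove]
        simp [hessenberg, this]
    -- The first column is r 0, 1, 0, 0, ...: deleting row 0 leaves a contiguous minor, and deleting
    -- row 1 leaves a smaller matrix of the same kind.
    rw [Matrix.det_succ_column_zero, Fin.sum_univ_succ, Fin.sum_univ_succ, hA,
      Finset.sum_eq_zero (s := Finset.univ), Finset.sum_range_succ']
    · rw [Fin.succ_zero_eq_one, hB, ih (fun t => r (t + 1)) (fun i j => g (i + 1) (j + 1))
        (fun i j h => h0 _ _ (by omega)) (fun i => h1 _)]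
      have : hessenberg r g (m + 1) 1 0 = 1 := h1 0
      rw [this]
      simp only [hessenberg, Fin.val_zero, Fin.val_one, pow_zero, pow_one, Matrix.of_apply,
        Fin.cases_zero, one_mul, mul_one, add_zero, Nat.sub_zero, neg_mul, ← Finset.sum_neg_distrib]
      rw [add_comm]
      congr 1
      refine Finset.sum_congr rfl fun t _ => ?_
      rw [show m + 1 - (t + 1) = m - t by omega]
      have : shiftedMinor (fun i j => g (i + 1) (j + 1)) t (m - t) =
          shiftedMinor g (t + 1) (m - t) := by
        unfold shiftedMinor
        congr 1
        ext i j
        simp only [Matrix.of_apply]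
        congr 1 <;> omega
      rw [this]
      ring
    · intro i _
      have : hessenberg r g (m + 1) i.succ.succ 0 = 0 := h0 _ _ (by simp)
      simp [this]

/-- The inverse of a unitriangular matrix by its contiguous minors. -/
theorem unitriangular_mul_minors (n : ℕ) (g : ℕ → ℕ → R) (h0 : ∀ i j, j < i → g i j = 0)
    (h1 : ∀ i, g i i = 1) :
    (Matrix.of fun x y : Fin n => g x y) *
      (Matrix.of fun t u : Fin n =>
        if (t : ℕ) ≤ u then (-1) ^ ((t : ℕ) + u) * shiftedMinor g t (u - t) else 0) = 1 := by
  ext x u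
  rw [Matrix.mul_apply]
  simp only [Matrix.of_apply]
  rw [Fin.sum_univ_eq_sum_range (fun t => g x t *
    (if t ≤ u then (-1) ^ (t + (u : ℕ)) * shiftedMinor g t (u - t) else 0)) n]
  rcases lt_trichotomy (x : ℕ) u with hxu | hxu | hxu
  · rw [Matrix.one_apply_ne (fun h => by simp [h] at hxu)]
    -- Up to sign, the entry above the diagonal is the expansion of a Hessenberg determinant whose
    -- first row repeats row x of g, hence zero.
    have hz : ∑ t ∈ Finset.range (u + 1), (-1) ^ t * g x t * shiftedMinor g t (u - t) = 0 := by
      rw [← det_hessenberg u (fun t => g x t) g h0 h1]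
      refine Matrix.det_zero_of_row_eq (i := 0) (j := Fin.succ ⟨x, hxu⟩) (Fin.succ_ne_zero _).symm ?_
      ext j
      simp [hessenberg]
    rw [← Finset.sum_subset (s₁ := Finset.range (u + 1))]
    · trans (-1) ^ (u : ℕ) *
        ∑ t ∈ Finset.range (u + 1), (-1) ^ t * g x t * shiftedMinor g t (u - t)
      · rw [Finset.mul_sum]
        refine Finset.sum_congr rfl fun t ht => ?_
        rw [if_pos (by simpa [Nat.lt_succ_iff] using ht)]
        ring
      · rw [hz, mul_zero]
    · intro t ht
      have := u.isLt
      simp at ht ⊢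
      omega
    · intro t _ ht
      rw [if_neg (by simpa [Nat.lt_succ_iff] using ht), mul_zero]
  · obtain rfl : x = u := Fin.ext hxu
    rw [Finset.sum_eq_single (x : ℕ)]
    · have : shiftedMinor g x 0 = 1 :=
        Matrix.det_fin_zero
      simp [h1, this, ← two_mul]
    · intro t _ ht
      rcases lt_or_gt_of_ne ht with h | h
      · rw [h0 _ _ h, zero_mul]
      · rw [if_neg (by omega), mul_zero]
    · simp
  · rw [Matrix.one_apply_ne (fun h => by simp [h] at hxu)]
    refine Finset.sum_eq_zero fun t _ => ?_
    by_cases h : t < x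
    · rw [h0 _ _ h, zero_mul]
    · rw [if_neg (by omega), mul_zero]

theorem one_submatrix_mul_apply {n k β : Type*} [DecidableEq n] [Fintype k] [DecidableEq k]
    {f : k → n} (hf : Function.Injective f)
    (Y : Matrix k β R) (a : k) (j : β) :
    ((1 : Matrix n n R).submatrix id f * Y) (f a) j = Y a j := by
  simp [Matrix.mul_apply, Matrix.one_apply, hf.eq_iff]

theorem one_submatrix_mul_apply_of_notMem {n k β : Type*} [DecidableEq n] [Fintype k]
    {f : k → n} (Y : Matrix k β R) {i : n} (hi : i ∉ Set.range f) (j : β) :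
    ((1 : Matrix n n R).submatrix id f * Y) i j = 0 := by
  rw [Matrix.mul_apply]
  refine Finset.sum_eq_zero fun a _ => ?_
  rw [submatrix_apply, id, Matrix.one_apply_ne (fun h => hi ⟨a, h.symm⟩), zero_mul]

variable {n k l : Type*} [Fintype n] [DecidableEq n] [Fintype k] [DecidableEq k] [Fintype l]
  [DecidableEq l]

/-- The determinant of a matrix obtained from the invertible matrix `U` by replacing rows and
columns. -/
theorem det_replace_rows_cols (U V : Matrix n n R) (hUV : U * V = 1) (P : Matrix n k R)
    (Q : Matrix n l R) (A : Matrix k l R) (C : Matrix k n R) (hP : Pᵀ * P = 1) (hQ : Qᵀ * Q = 1) :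
    ((U + P * (C - Pᵀ * U)) * (1 - Q * Qᵀ) + P * A * Qᵀ).det =
      U.det * ((-1) ^ Fintype.card l *
        (fromBlocks (C * V * P) A (Qᵀ * V * P) 0).det) := by
  have hVU : V * U = 1 := mul_eq_one_comm.1 hUV
  set K := C - Pᵀ * U with hK
  have hKV : K * V = C * V - Pᵀ := by rw [hK, Matrix.sub_mul, Matrix.mul_assoc, hUV, Matrix.mul_one]
  have hKVP : K * V * P = C * V * P - 1 := by rw [hKV, Matrix.sub_mul, hP]
  -- With U factored out, the rest is the identity plus a product through `k ⊕ l`, so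
  -- `det_one_add_mul_comm` moves the determinant to size k + l.
  have hM : (U + P * K) * (1 - Q * Qᵀ) + P * A * Qᵀ =
      U * (1 + V * fromCols P (P * A - (U + P * K) * Q) * fromRows K Qᵀ) := by
    rw [Matrix.mul_add, Matrix.mul_one, ← Matrix.mul_assoc, ← Matrix.mul_assoc, hUV, Matrix.one_mul,
      fromCols_mul_fromRows, Matrix.mul_sub, Matrix.mul_one, Matrix.sub_mul, Matrix.mul_assoc _ Q]
    abel
  rw [hM, det_mul, det_one_add_mul_comm, ← Matrix.mul_assoc, fromRows_mul, fromRows_mul_fromCols,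
    ← fromBlocks_one, fromBlocks_add]
  congr 1
  have h11 : 1 + K * V * P = C * V * P := by rw [hKVP]; abel
  have h12 : 0 + K * V * (P * A - (U + P * K) * Q) =
      C * V * P * (A - K * Q) + (-A) := by
    have e1 : K * V * ((U + P * K) * Q) = K * Q + (C * V * P - 1) * (K * Q) := by
      rw [Matrix.add_mul, Matrix.mul_add, ← Matrix.mul_assoc (K * V), Matrix.mul_assoc K V U, hVU, Matrix.mul_one,
        Matrix.mul_assoc P K Q, ← Matrix.mul_assoc (K * V) P, hKVP]
    rw [Matrix.mul_sub, ← Matrix.mul_assoc (K * V) P, hKVP, e1]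
    simp only [Matrix.sub_mul, Matrix.mul_sub, Matrix.one_mul]
    abel
  have h22 : 1 + Qᵀ * V * (P * A - (U + P * K) * Q) = Qᵀ * V * P * (A - K * Q) := by
    have e1 : Qᵀ * V * ((U + P * K) * Q) = 1 + Qᵀ * V * P * (K * Q) := by
      rw [Matrix.add_mul, Matrix.mul_add, ← Matrix.mul_assoc (Qᵀ * V), Matrix.mul_assoc Qᵀ V U, hVU,
        Matrix.mul_one, hQ, Matrix.mul_assoc P K Q, ← Matrix.mul_assoc (Qᵀ * V) P]
    rw [Matrix.mul_sub, ← Matrix.mul_assoc (Qᵀ * V) P, e1, Matrix.mul_sub]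
    abel
  -- The small matrix is the desired block matrix times a block triangular one; the diagonal block
  -- -1 of the latter produces the sign.
  have h : fromBlocks (1 + K * V * P) (0 + K * V * (P * A - (U + P * K) * Q))
      (0 + Qᵀ * V * P) (1 + Qᵀ * V * (P * A - (U + P * K) * Q)) =
      fromBlocks (C * V * P) A (Qᵀ * V * P) 0 *
        fromBlocks (1 : Matrix k k R) (A - K * Q) 0 (-1 : Matrix l l R) := by
    rw [h11, h12, h22, zero_add, fromBlocks_multiply]
    simp
  rw [h, det_mul, det_fromBlocks_zero₂₁, det_one, one_mul, det_neg, det_one, mul_one, mul_comm]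

theorem transpose_one_submatrix_mul {α β : Type*} (f : α → n) (Y : Matrix n β R) :
    ((1 : Matrix n n R).submatrix id f)ᵀ * Y = Y.submatrix f id := by
  ext i j
  simp [Matrix.mul_apply, Matrix.one_apply]

theorem mul_one_submatrix {α β : Type*} (f : α → n) (Y : Matrix β n R) :
    Y * (1 : Matrix n n R).submatrix id f = Y.submatrix id f := by
  ext i j
  simp [Matrix.mul_apply, Matrix.one_apply]

/-- The case of `det_replace_rows_cols` in which the rows `p` and the columns `q` are replaced. -/
theorem det_of_replaced (U V M : Matrix n n R) (hUV : U * V = 1) {p : k → n} {q : l → n}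
    (hp : Function.Injective p) (hq : Function.Injective q) (A : Matrix k l R) (C : Matrix k n R)
    (hpq : ∀ a b, M (p a) (q b) = A a b) (hC : ∀ a, ∀ j ∉ Set.range q, M (p a) j = C a j)
    (h0 : ∀ b, ∀ i ∉ Set.range p, M i (q b) = 0)
    (hU : ∀ i ∉ Set.range p, ∀ j ∉ Set.range q, M i j = U i j) :
    M.det = U.det * ((-1) ^ Fintype.card l *
      (fromBlocks (C * V.submatrix id p) A (V.submatrix q p) 0).det) := by
  set P : Matrix n k R := (1 : Matrix n n R).submatrix id p with hPdef
  set Q : Matrix n l R := (1 : Matrix n n R).submatrix id q with hQdef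
  have hP : Pᵀ * P = 1 := by
    rw [hPdef, transpose_one_submatrix_mul, submatrix_submatrix]
    exact submatrix_one p hp
  have hQ : Qᵀ * Q = 1 := by
    rw [hQdef, transpose_one_submatrix_mul, submatrix_submatrix]
    exact submatrix_one q hq
  have mulP : ∀ (Y : Matrix k n R) (a : k) (j : n), (P * Y) (p a) j = Y a j :=
    one_submatrix_mul_apply hp
  have mulP0 : ∀ (Y : Matrix k n R) (i : n) (j : n), i ∉ Set.range p → (P * Y) i j = 0 :=
    fun Y i j hi => one_submatrix_mul_apply_of_notMem Y hi j
  have tr : ∀ Y : Matrix n l R, Y * Qᵀ = (Q * Yᵀ)ᵀ := fun Y => by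
    rw [transpose_mul, transpose_transpose]
  have mulQ : ∀ (Y : Matrix n l R) (i : n) (c : l), (Y * Qᵀ) i (q c) = Y i c := fun Y i c => by
    rw [tr, transpose_apply, hQdef, one_submatrix_mul_apply hq, transpose_apply]
  have mulQ0 : ∀ (Y : Matrix n l R) (i : n) (j : n), j ∉ Set.range q → (Y * Qᵀ) i j = 0 :=
    fun Y i j hj => by
      rw [tr, transpose_apply, hQdef, one_submatrix_mul_apply_of_notMem _ hj]
  -- Adding `P * (C - Pᵀ * U)` overwrites the rows `p` of U by C, the factor `1 - Q * Qᵀ` clears the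
  -- columns `q`, and `P * A * Qᵀ` fills in their intersection with the rows `p`.
  have hM : M = (U + P * (C - Pᵀ * U)) * (1 - Q * Qᵀ) + P * A * Qᵀ := by
    set N := U + P * (C - Pᵀ * U) with hN
    have hNp : ∀ a j, N (p a) j = C a j := fun a j => by
      rw [hN, Matrix.add_apply, mulP, hPdef, transpose_one_submatrix_mul]
      simp
    have hN0 : ∀ i ∉ Set.range p, ∀ j, N i j = U i j := fun i hi j => by
      rw [hN, Matrix.add_apply, mulP0 _ _ _ hi, add_zero]
    rw [Matrix.mul_sub, Matrix.mul_one, ← Matrix.mul_assoc]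
    ext i j
    rw [Matrix.add_apply, Matrix.sub_apply]
    by_cases hj : j ∈ Set.range q
    · obtain ⟨c, rfl⟩ := hj
      rw [mulQ, mulQ, hQdef, mul_one_submatrix, submatrix_apply, id, sub_self, zero_add]
      by_cases hi : i ∈ Set.range p
      · obtain ⟨a, rfl⟩ := hi
        rw [hpq, hPdef, one_submatrix_mul_apply hp]
      · rw [h0 _ _ hi, hPdef, one_submatrix_mul_apply_of_notMem _ hi]
    · rw [mulQ0 _ _ _ hj, mulQ0 _ _ _ hj, sub_zero, add_zero]
      by_cases hi : i ∈ Set.range p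
      · obtain ⟨a, rfl⟩ := hi
        rw [hC _ _ hj, hNp]
      · rw [hU _ hi _ hj, hN0 _ hi]
  rw [hM, det_replace_rows_cols U V hUV P Q A C hP hQ, Matrix.mul_assoc C, Matrix.mul_assoc Qᵀ,
    hPdef, mul_one_submatrix, hQdef, transpose_one_submatrix_mul, submatrix_submatrix]
  rfl

end LinearAlgebra

/-! ### Frobenius notation as a permutation, and its sign. -/

section Frobenius

/-- For i < k every value below σ i is taken to the right of i, so i starts exactly σ i inversions.
For i ≥ k it starts none. -/
theorem sign_of_decreasing_increasing {n : ℕ} (σ : Equiv.Perm (Fin n)) (k : ℕ)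
    (h1 : ∀ i j : Fin n, (i : ℕ) < k → j < i → σ i < σ j)
    (h2 : ∀ i j : Fin n, k ≤ (i : ℕ) → i < j → σ i < σ j) :
    Equiv.Perm.sign σ = ∏ i : Fin n, if (i : ℕ) < k then (-1) ^ (σ i : ℕ) else 1 := by
  rw [Equiv.Perm.sign_eq_prod_prod_Ioi]
  refine Finset.prod_congr rfl fun i _ => ?_
  split_ifs with hi
  · rw [Finset.prod_ite, Finset.prod_const_one, one_mul, Finset.prod_const]
    congr 1
    rw [← Fin.card_Iio (σ i), ← Finset.card_map σ.toEmbedding]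
    congr 1
    ext x
    simp only [Finset.mem_map_equiv, Finset.mem_filter, Finset.mem_Ioi, Finset.mem_Iio,
      Equiv.apply_symm_apply, not_lt]
    refine ⟨fun ⟨ha, hb⟩ => lt_of_le_of_ne hb fun h => ?_, fun h => ⟨?_, h.le⟩⟩
    · rw [h, Equiv.symm_apply_apply] at ha
      exact lt_irrefl _ ha
    · by_contra hc
      rcases lt_or_eq_of_le (not_lt.1 hc) with h' | h'
      · have := h1 _ _ hi h'
        rw [Equiv.apply_symm_apply] at this
        exact lt_asymm h this
      · rw [← h', Equiv.apply_symm_apply] at h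
        exact lt_irrefl _ h
  · refine Finset.prod_eq_one fun j hj => if_pos (h2 _ _ (not_lt.1 hi) (Finset.mem_Ioi.1 hj))

/-- A diagram is closed under moving up and left, so its diagonal cells form an initial segment,
determined by their number. -/
theorem lt_durfee_iff (ν : YoungDiagram) (i : ℕ) : i < durfee ν ↔ (i, i) ∈ ν := by
  have hex : ∃ m, (m, m) ∉ ν :=
    ⟨ν.rowLen 0, fun h => by
      rw [YoungDiagram.mem_iff_lt_colLen, RShape.colLen_eq_zero le_rfl] at h
      exact Nat.not_lt_zero _ h⟩
  classical
  have hm : ∀ i, i < Nat.find hex ↔ (i, i) ∈ ν := fun i => by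
    refine ⟨fun h => not_not.1 (Nat.find_min hex h), fun h => ?_⟩
    by_contra hc
    exact Nat.find_spec hex (ν.up_left_mem (not_lt.1 hc) (not_lt.1 hc) h)
  have hd : durfee ν = Nat.find hex := by
    rw [durfee, ← Finset.card_range (Nat.find hex)]
    symm
    refine Finset.card_bij (fun i _ => (i, i)) ?_ ?_ ?_
    · intro i hi
      exact Finset.mem_filter.2 ⟨(hm i).1 (Finset.mem_range.1 hi), rfl⟩
    · intro i _ j _ h
      exact congrArg Prod.fst h
    · rintro ⟨i, j⟩ h
      obtain ⟨h, rfl : i = j⟩ := Finset.mem_filter.1 h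
      exact ⟨i, Finset.mem_range.2 ((hm i).2 h), rfl⟩
  rw [hd, hm]

theorem lt_durfee_iff_colLen (ν : YoungDiagram) (i : ℕ) : i < durfee ν ↔ i < ν.colLen i := by
  rw [lt_durfee_iff, YoungDiagram.mem_iff_lt_colLen]

theorem lt_durfee_iff_rowLen (ν : YoungDiagram) (i : ℕ) : i < durfee ν ↔ i < ν.rowLen i := by
  rw [lt_durfee_iff, YoungDiagram.mem_iff_lt_rowLen]

theorem lt_colLen_iff_lt_rowLen (ν : YoungDiagram) (i j : ℕ) : i < ν.colLen j ↔ j < ν.rowLen i := by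
  rw [← YoungDiagram.mem_iff_lt_colLen, YoungDiagram.mem_iff_lt_rowLen]

theorem durfee_le_rowLen (ν : YoungDiagram) : durfee ν ≤ ν.rowLen 0 := by
  by_contra h
  have h1 := (lt_durfee_iff_rowLen ν _).1 (not_le.1 h)
  exact absurd h1 (not_lt.2 (ν.rowLen_anti _ _ (Nat.zero_le _)))

/-- The permutation of the columns that lists the arms of the diagonal cells and then the
remaining numbers in increasing order. -/
def frobeniusFun (ν : YoungDiagram) (i : ℕ) : ℕ :=
  if i < durfee ν then arm ν i else i - ν.colLen i

theorem frobeniusFun_lt {ν : YoungDiagram} {n i : ℕ} (hn : ν.rowLen 0 ≤ n) (hi : i < n) :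
    frobeniusFun ν i < n := by
  unfold frobeniusFun arm
  have := ν.rowLen_anti 0 i (Nat.zero_le _)
  split_ifs <;> omega

theorem frobeniusFun_lt_of_lt {ν : YoungDiagram} {i j : ℕ} (hi : i < durfee ν) (hj : j < i) :
    frobeniusFun ν i < frobeniusFun ν j := by
  have := ν.rowLen_anti j i hj.le
  have := (lt_durfee_iff_rowLen ν i).1 hi
  rw [frobeniusFun, frobeniusFun, if_pos hi, if_pos (hj.trans hi), arm, arm]
  omega

theorem frobeniusFun_lt_of_ge {ν : YoungDiagram} {i j : ℕ} (hi : durfee ν ≤ i) (hj : i < j) :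
    frobeniusFun ν i < frobeniusFun ν j := by
  have := ν.colLen_anti i j hj.le
  have := not_lt.1 (mt (lt_durfee_iff_colLen ν i).2 (not_lt.2 hi))
  rw [frobeniusFun, frobeniusFun, if_neg (not_lt.2 hi), if_neg (not_lt.2 (hi.trans hj.le))]
  omega

/-- If cell (i, j) lies in ν then the arm at i is at least j - i, which exceeds j - ν'_j; otherwise
the arm is at most j - i - 1, which is less than j - ν'_j. -/
theorem frobeniusFun_ne {ν : YoungDiagram} {i j : ℕ} (hi : i < durfee ν) (hj : durfee ν ≤ j) :
    frobeniusFun ν i ≠ frobeniusFun ν j := by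
  have := (lt_durfee_iff_rowLen ν i).1 hi
  have := not_lt.1 (mt (lt_durfee_iff_colLen ν j).2 (not_lt.2 hj))
  have := lt_colLen_iff_lt_rowLen ν i j
  rw [frobeniusFun, frobeniusFun, if_pos hi, if_neg (not_lt.2 hj), arm]
  omega

theorem frobeniusFun_injective (ν : YoungDiagram) : Function.Injective (frobeniusFun ν) := by
  have key : ∀ i j, i < j → frobeniusFun ν i ≠ frobeniusFun ν j := fun i j hij => by
    by_cases hi : i < durfee ν
    · by_cases hj : j < durfee ν
      · exact (frobeniusFun_lt_of_lt hj hij).ne'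
      · exact frobeniusFun_ne hi (not_lt.1 hj)
    · exact (frobeniusFun_lt_of_ge (not_lt.1 hi) hij).ne
  intro i j h
  by_contra hne
  rcases lt_or_gt_of_ne hne with h' | h'
  · exact key _ _ h' h
  · exact key _ _ h' h.symm

/-- `frobeniusFun` as a permutation of the first `n ≥ ν_1` columns. -/
noncomputable def frobeniusPerm (ν : YoungDiagram) {n : ℕ} (hn : ν.rowLen 0 ≤ n) :
    Equiv.Perm (Fin n) :=
  Equiv.ofBijective (fun i => ⟨frobeniusFun ν i, frobeniusFun_lt hn i.isLt⟩)
    (Finite.injective_iff_bijective.1 fun _ _ h =>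
      Fin.ext (frobeniusFun_injective ν (congrArg Fin.val h)))

theorem frobeniusPerm_apply (ν : YoungDiagram) {n : ℕ} (hn : ν.rowLen 0 ≤ n) (i : Fin n) :
    (frobeniusPerm ν hn i : ℕ) = frobeniusFun ν i := rfl

/-- These signs later cancel the checkerboard signs of the inverse matrix. -/
theorem sign_frobeniusPerm (ν : YoungDiagram) {n : ℕ} (hn : ν.rowLen 0 ≤ n) :
    Equiv.Perm.sign (frobeniusPerm ν hn) = ∏ i : Fin (durfee ν), (-1) ^ arm ν i := by
  rw [sign_of_decreasing_increasing (frobeniusPerm ν hn) (durfee ν)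
    (fun i j hi hj => frobeniusFun_lt_of_lt hi hj) (fun i j hi hj => frobeniusFun_lt_of_ge hi hj)]
  simp only [frobeniusPerm_apply]
  rw [Fin.prod_univ_eq_prod_range
    (fun i => if i < durfee ν then (-1 : ℤˣ) ^ frobeniusFun ν i else 1) n,
    Fin.prod_univ_eq_prod_range (fun i => (-1 : ℤˣ) ^ arm ν i) (durfee ν)]
  rw [← Finset.prod_subset (s₁ := Finset.range (durfee ν))]
  · refine Finset.prod_congr rfl fun i hi => ?_
    rw [if_pos (Finset.mem_range.1 hi), frobeniusFun, if_pos (Finset.mem_range.1 hi)]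
  · exact Finset.range_subset_range.2 ((durfee_le_rowLen ν).trans hn)
  · intro i _ hi
    exact if_neg (fun h => hi (Finset.mem_range.2 h))

end Frobenius

/-! ### The Jacobi-Trudi matrix as a function of contents. -/

section Kernel

variable {R : Type*} [CommRing R]

theorem superElem_zero (y z : ℤ → R) (s t : Finset ℤ) : superElem y z s t 0 = 1 := by
  change superElem y z s t (Int.ofNat 0) = 1
  simp only [superElem, elemSymm, complSymm, zero_add, Finset.sum_range_one, Multiset.esymm]
  simp
  rfl

theorem superElem_of_neg (y z : ℤ → R) (s t : Finset ℤ) {n : ℤ} (hn : n < 0) :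
    superElem y z s t n = 0 := by
  obtain ⟨m, rfl⟩ := Int.eq_negSucc_of_lt_zero hn
  rfl

/-- The function of a column with contents from `B` to `t` and flags `a`, `b`. -/
noncomputable def columnElem (y z : ℤ → R) (a b B t : ℤ) : R :=
  superElem y z (Finset.Icc a b) (Finset.Icc (a + t) (b + B)) (t - B + 1)

theorem columnElem_of_lt (y z : ℤ → R) (a b : ℤ) {B t : ℤ} (h : t + 1 < B) :
    columnElem y z a b B t = 0 :=
  superElem_of_neg _ _ _ _ (by omega)

theorem columnElem_of_eq (y z : ℤ → R) (a b : ℤ) {B t : ℤ} (h : t + 1 = B) :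
    columnElem y z a b B t = 1 := by
  rw [columnElem, show t - B + 1 = 0 by omega, superElem_zero]

namespace RShape

theorem topContent_eq (s : RShape) (j : ℕ) :
    s.topContent j = s.content 0 0 + j - s.inner.colLen j := by
  simp only [topContent, content]
  ring

theorem botContent_eq (s : RShape) (j : ℕ) :
    s.botContent j = s.content 0 0 + j + 1 - s.outer.colLen j := by
  simp only [botContent, content]
  ring

/-- The degree λ'_i - i - μ'_j + j is top content minus bottom content plus one, so apart from the
flags only contents enter. -/
theorem schurMatrix_apply (s : RShape) (a b : ℕ → ℤ) (y z : ℤ → R) (n : ℕ) (i j : Fin n) :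
    s.schurMatrix a b y z n i j =
      columnElem y z (a j) (b i) (s.botContent i) (s.topContent j) := by
  simp only [schurMatrix, Matrix.of_apply, columnElem, conjA, conjB]
  congr 1
  rw [topContent_eq, botContent_eq]
  ring

/-- The lower flag that `a` induces at the top content `t` of a column. -/
noncomputable def lowerFlag (s : RShape) (a : ℕ → ℤ) (t : ℤ) : ℤ :=
  a (s.minCol t) - ((s.inner.colLen (s.minCol t) : ℤ) + 1) + ((s.minRow t : ℤ) + 1)

/-- The upper flag that `b` induces at the bottom content `B` of a column. -/
noncomputable def upperFlag (s : RShape) (b : ℕ → ℤ) (B : ℤ) : ℤ :=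
  b (s.maxCol B) - (s.outer.colLen (s.maxCol B) : ℤ) + ((s.maxRow B : ℤ) + 1)

/-- The function of the vertical strip with contents from `B` to `t`, with induced flags. -/
noncomputable def kernel (s : RShape) (a b : ℕ → ℤ) (y z : ℤ → R) (B t : ℤ) : R :=
  columnElem y z (s.lowerFlag a t) (s.upperFlag b B) B t

theorem kernel_of_lt (s : RShape) (a b : ℕ → ℤ) (y z : ℤ → R) {B t : ℤ} (h : t + 1 < B) :
    s.kernel a b y z B t = 0 :=
  columnElem_of_lt _ _ _ _ h

theorem kernel_of_eq (s : RShape) (a b : ℕ → ℤ) (y z : ℤ → R) {B t : ℤ} (h : t + 1 = B) :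
    s.kernel a b y z B t = 1 :=
  columnElem_of_eq _ _ _ _ h

/-- The flags induced on any ribbon are values of `lowerFlag` and `upperFlag` at contents, so all
ribbons share the same `kernel`. -/
theorem ribbonSchur_eq (s : RShape) (a b : ℕ → ℤ) (y z : ℤ → R) (θ : RShape) {n : ℕ}
    (hn : θ.outer.rowLen 0 = n) :
    s.ribbonSchur a b y z θ =
      (Matrix.of fun i j : Fin n =>
        s.kernel a b y z (θ.botContent i) (θ.topContent j)).det := by
  subst hn
  rw [ribbonSchur, schur]
  congr 1
  ext i j
  rw [schurMatrix_apply]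
  rfl

theorem mem_cells_iff (s : RShape) (i j : ℕ) :
    (i, j) ∈ s.cells ↔ s.inner.colLen j ≤ i ∧ i < s.outer.colLen j := by
  rw [cells, Finset.mem_sdiff, YoungDiagram.mem_cells, YoungDiagram.mem_cells,
    YoungDiagram.mem_iff_lt_colLen, YoungDiagram.mem_iff_lt_colLen, not_lt, and_comm]

theorem inner_colLen_le (s : RShape) (j : ℕ) : s.inner.colLen j ≤ s.outer.colLen j := by
  by_contra h
  have h1 := YoungDiagram.mem_iff_lt_colLen.2 (not_le.1 h)
  exact lt_irrefl _ (YoungDiagram.mem_iff_lt_colLen.1 (s.inner_le h1))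

theorem inner_rowLen_le (s : RShape) (i : ℕ) : s.inner.rowLen i ≤ s.outer.rowLen i := by
  by_contra h
  have h1 := YoungDiagram.mem_iff_lt_rowLen.2 (not_le.1 h)
  exact lt_irrefl _ (YoungDiagram.mem_iff_lt_rowLen.1 (s.inner_le h1))

/-- Moving up and left from the top cell of a column enters the inner shape, so that cell is itself
the leftmost of its content. -/
theorem lowerFlag_topContent (s : RShape) (a : ℕ → ℤ) {j : ℕ}
    (h : s.inner.colLen j < s.outer.colLen j) : s.lowerFlag a (s.topContent j) = a j := by
  have hm : (s.inner.colLen j, j) ∈ s.cells := (s.mem_cells_iff _ _).2 ⟨le_rfl, h⟩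
  obtain ⟨⟨hc, he⟩, hmin⟩ := s.min_spec (c := s.topContent j) ⟨_, _, hm, rfl⟩
  have hle := hmin _ _ hm rfl
  have h1 := ((s.mem_cells_iff _ _).1 hc).1
  have h2 := s.inner.colLen_anti _ _ hle
  have hj : s.minCol (s.topContent j) = j := by
    simp only [topContent, content] at he hle h1 h2 ⊢
    omega
  rw [lowerFlag, hj]
  rw [hj] at he
  simp only [topContent, content] at he ⊢
  omega

/-- Dually, moving down and right from the bottom cell of a column leaves the outer shape. -/
theorem upperFlag_botContent (s : RShape) (b : ℕ → ℤ) {j : ℕ}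
    (h : s.inner.colLen j < s.outer.colLen j) : s.upperFlag b (s.botContent j) = b j := by
  have hm : (s.outer.colLen j - 1, j) ∈ s.cells := (s.mem_cells_iff _ _).2 ⟨by omega, by omega⟩
  have hb : s.content ((s.outer.colLen j - 1 : ℕ) : ℤ) j = s.botContent j := by
    rw [botContent, Nat.cast_sub (by omega), Nat.cast_one]
  obtain ⟨⟨hc, he⟩, hmax⟩ := s.max_spec (c := s.botContent j) ⟨_, _, hm, hb⟩
  have hle := hmax _ _ hm hb
  have h1 := ((s.mem_cells_iff _ _).1 hc).2
  have h2 := s.outer.colLen_anti _ _ hle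
  have hj : s.maxCol (s.botContent j) = j := by
    simp only [botContent, content] at he hle h1 h2 ⊢
    omega
  rw [upperFlag, hj]
  rw [hj] at he
  simp only [botContent, content] at he ⊢
  omega

theorem topContent_lt (s : RShape) {i j : ℕ} (h : i < j) : s.topContent i < s.topContent j := by
  have := s.inner.colLen_anti i j h.le
  rw [topContent_eq, topContent_eq]
  omega

theorem botContent_le_iff (s : RShape) {i j : ℕ} :
    s.botContent i ≤ s.botContent j ↔ i ≤ j := by
  rw [botContent_eq, botContent_eq]
  rcases le_or_gt i j with h | h
  · have := s.outer.colLen_anti i j h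
    omega
  · have := s.outer.colLen_anti j i h.le
    omega

/-- A permutation that contributes to the Jacobi-Trudi determinant fixes the empty columns. -/
theorem perm_fixes_empty_column (s : RShape) {n : ℕ} (σ : Equiv.Perm (Fin n))
    (hσ : ∀ j : Fin n, s.botContent (σ j) ≤ s.topContent j + 1) {j : Fin n}
    (hj : s.inner.colLen j = s.outer.colLen j) : σ j = j := by
  have hb : s.botContent j = s.topContent j + 1 := by
    rw [topContent_eq, botContent_eq, hj]
    ring
  have hle : σ j ≤ j := s.botContent_le_iff.1 (hb ▸ hσ j)
  have hlt : ∀ i, i < j → σ i < j := fun i hi => by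
    have h1 := hσ i
    have h2 := s.topContent_lt hi
    by_contra hc
    have h3 := s.botContent_le_iff.2 (Fin.le_def.1 (not_lt.1 hc))
    omega
  by_contra hne
  have hlt' : σ j < j := lt_of_le_of_ne hle hne
  -- If σ j < j, then σ would inject the columns up to j into those strictly before j.
  have hmap : (Finset.Iic j).map σ.toEmbedding ⊆ Finset.Iio j := by
    intro x hx
    obtain ⟨i, hi, rfl⟩ := Finset.mem_map.1 hx
    rcases lt_or_eq_of_le (Finset.mem_Iic.1 hi) with h | rfl
    · exact Finset.mem_Iio.2 (hlt i h)
    · exact Finset.mem_Iio.2 hlt'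
  have := Finset.card_le_card hmap
  rw [Finset.card_map, Fin.card_Iic, Fin.card_Iio] at this
  omega

/-- The two matrices may differ at empty columns, where `lowerFlag` and `upperFlag` need not return
the given flags. The Leibniz expansions still agree term by term: a nonvanishing term meets an empty
column only on the diagonal. -/
theorem schur_eq_det_kernel (s : RShape) (a b : ℕ → ℤ) (y z : ℤ → R) :
    s.schur a b y z = (Matrix.of fun i j : Fin (s.outer.rowLen 0) =>
      s.kernel a b y z (s.botContent i) (s.topContent j)).det := by
  rw [schur, Matrix.det_apply, Matrix.det_apply]
  refine Finset.sum_congr rfl fun σ _ => ?_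
  congr 1
  simp only [schurMatrix_apply, Matrix.of_apply]
  by_cases hσ : ∀ j : Fin (s.outer.rowLen 0), s.botContent (σ j) ≤ s.topContent j + 1
  · refine Finset.prod_congr rfl fun j _ => ?_
    rcases lt_or_eq_of_le (s.inner_colLen_le j) with h | h
    · have h' : s.inner.colLen (σ j) < s.outer.colLen (σ j) := by
        refine lt_of_le_of_ne (s.inner_colLen_le _) fun he => ?_
        have := σ.injective (s.perm_fixes_empty_column σ hσ he)
        rw [this] at he
        exact h.ne he
      rw [kernel, lowerFlag_topContent s a h, upperFlag_botContent s b h']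
    -- In an empty column the diagonal entry has degree 0, so it is 1 whatever the flags.
    · have hb : s.topContent j + 1 = s.botContent j := by
        rw [topContent_eq, botContent_eq, h]
        ring
      rw [s.perm_fixes_empty_column σ hσ h, kernel_of_eq _ _ _ _ _ hb, columnElem_of_eq _ _ _ _ hb]
  · push Not at hσ
    obtain ⟨j, hj⟩ := hσ
    rw [Finset.prod_eq_zero (Finset.mem_univ j) (columnElem_of_lt _ _ _ _ hj),
      Finset.prod_eq_zero (Finset.mem_univ j) (kernel_of_lt _ _ _ _ _ hj)]

end RShape

end Kernel

/-! ### Hooks and strips in terms of the kernel, and assembly of the formula. -/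

section Giambelli

variable {R : Type*} [CommRing R]

theorem colLen_eq_of_forall {ν : YoungDiagram} {j m : ℕ} (h : ∀ i, (i, j) ∈ ν ↔ i < m) :
    ν.colLen j = m :=
  eq_of_forall_lt_iff fun i => by rw [← YoungDiagram.mem_iff_lt_colLen, h]

theorem rowLen_eq_of_forall {ν : YoungDiagram} {i m : ℕ} (h : ∀ j, (i, j) ∈ ν ↔ j < m) :
    ν.rowLen i = m :=
  eq_of_forall_lt_iff fun j => by rw [← YoungDiagram.mem_iff_lt_rowLen, h]

theorem mem_rect {m n i j : ℕ} : (i, j) ∈ rect m n ↔ i < m ∧ j < n := by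
  rw [← YoungDiagram.mem_cells]
  simp [rect]

theorem mem_hook {u v i j : ℕ} : (i, j) ∈ hook u v ↔ i = 0 ∧ j ≤ u ∨ i ≤ v ∧ j = 0 := by
  rw [hook, YoungDiagram.mem_sup, mem_rect, mem_rect]
  omega

namespace RShape

theorem straight_topContent (ν : YoungDiagram) (r : ℤ) (j : ℕ) :
    (straight ν r).topContent j = r - 1 + ν.colLen 0 + j := by
  have : (⊥ : YoungDiagram).colLen j = 0 :=
    colLen_eq_of_forall fun i => by simp [YoungDiagram.notMem_bot]
  simp only [topContent_eq, content, straight, this]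
  push_cast
  ring

theorem straight_botContent (ν : YoungDiagram) (r : ℤ) (j : ℕ) :
    (straight ν r).botContent j = r + ν.colLen 0 + j - ν.colLen j := by
  simp only [botContent_eq, content, straight]
  ring

variable (s : RShape) (a b : ℕ → ℤ) (y z : ℤ → R)

/-- The kernel at nonnegative contents, relative to the content of the position in the first row
and first column. -/
noncomputable def shiftedKernel (i j : ℕ) : R :=
  s.kernel a b y z (s.content 0 0 + i + 1) (s.content 0 0 + j)

theorem shiftedKernel_of_lt (i j : ℕ) (h : j < i) : s.shiftedKernel a b y z i j = 0 :=
  kernel_of_lt _ _ _ _ _ (by omega)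

theorem shiftedKernel_self (i : ℕ) : s.shiftedKernel a b y z i i = 1 :=
  kernel_of_eq _ _ _ _ _ (by omega)

/-- Only the first column of a hook reaches below the first row, so its Jacobi-Trudi matrix is a
Hessenberg matrix: one special row above rows of the unitriangular `shiftedKernel`. -/
theorem hookEntry_eq (i j : ℕ) :
    s.hookEntry a b y z i j = ∑ t ∈ Finset.range (arm s.outer j + 1),
      (-1) ^ t * s.kernel a b y z (s.content 0 0 - leg s.outer i) (s.content 0 0 + t) *
        shiftedMinor (s.shiftedKernel a b y z) t (arm s.outer j - t) := by
  rw [← det_hessenberg _ _ _ (s.shiftedKernel_of_lt a b y z) (s.shiftedKernel_self a b y z),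
    hookEntry, ribbonSchur_eq (n := arm s.outer j + 1)]
  · congr 1
    ext p q
    rw [hookRibbon, Matrix.of_apply, straight_topContent, straight_botContent]
    have h0 : (hook (arm s.outer j) (leg s.outer i)).colLen 0 = leg s.outer i + 1 :=
      colLen_eq_of_forall fun x => by rw [mem_hook]; omega
    rw [h0, show s.content 0 0 - leg s.outer i - 1 + ((leg s.outer i + 1 : ℕ) : ℤ) + (q : ℕ) =
      s.content 0 0 + (q : ℕ) by push_cast; ring]
    refine Fin.cases ?_ (fun p => ?_) p
    · rw [Fin.val_zero, h0]
      change _ = s.kernel a b y z _ _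
      congr 1
      push_cast
      ring
    · have h1 : (hook (arm s.outer j) (leg s.outer i)).colLen (p.succ : Fin _) = 1 :=
        colLen_eq_of_forall fun x => by
          have := p.isLt
          rw [mem_hook, Fin.val_succ]
          omega
      rw [h1]
      change _ = s.kernel a b y z _ _
      congr 1
      rw [Fin.val_succ]
      push_cast
      ring
  · exact rowLen_eq_of_forall fun x => by
      change (0, x) ∈ hook _ _ ↔ _
      rw [mem_hook]
      omega

theorem vertEntry_eq (i j : ℕ) :
    s.vertEntry a b y z i j = s.kernel a b y z (s.content 0 0 - leg s.outer i)
      (s.content 0 0 - leg s.inner j - 1) := by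
  rw [vertEntry]
  split_ifs with h
  · rcases lt_or_eq_of_le h with h' | h'
    · have h0 : (rect (leg s.outer i - leg s.inner j) 1).colLen 0 =
          leg s.outer i - leg s.inner j :=
        colLen_eq_of_forall fun x => by rw [mem_rect]; omega
      rw [ribbonSchur_eq (n := 1), Matrix.det_fin_one, Matrix.of_apply, vertRibbon,
        straight_topContent, straight_botContent]
      · simp only [Fin.val_zero, h0]
        congr 1 <;> push_cast [h] <;> ring
      · exact rowLen_eq_of_forall fun x => by
          change (0, x) ∈ rect _ _ ↔ _
          rw [mem_rect]
          omega
    · rw [ribbonSchur_eq (n := 0), Matrix.det_fin_zero, kernel_of_eq _ _ _ _ _ (by omega)]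
      exact rowLen_eq_of_forall fun x => by
        change (0, x) ∈ rect _ _ ↔ _
        rw [mem_rect]
        omega
  · rw [kernel_of_lt _ _ _ _ _ (by omega)]

theorem horizEntry_eq (i j : ℕ) :
    s.horizEntry a b y z i j = if arm s.inner i ≤ arm s.outer j then
      shiftedMinor (s.shiftedKernel a b y z) (arm s.inner i) (arm s.outer j - arm s.inner i)
      else 0 := by
  rw [horizEntry]
  refine if_congr Iff.rfl ?_ rfl
  have hc : ∀ x < arm s.outer j - arm s.inner i,
      (rect 1 (arm s.outer j - arm s.inner i)).colLen x = 1 := fun x hx =>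
    colLen_eq_of_forall fun w => by rw [mem_rect]; omega
  rw [ribbonSchur_eq (n := arm s.outer j - arm s.inner i), shiftedMinor]
  · congr 1
    ext p q
    rw [Matrix.of_apply, Matrix.of_apply, horizRibbon, straight_topContent, straight_botContent,
      hc _ p.isLt, hc 0 (by have := p.isLt; omega), shiftedKernel]
    congr 1 <;> push_cast <;> ring
  · exact rowLen_eq_of_forall fun x => by
      change (0, x) ∈ rect _ _ ↔ _
      rw [mem_rect]
      omega

end RShape

/-- This and the next three lemmas split the contents at the diagonal: legs describe those of the
first columns, `frobeniusFun` those of the others. -/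
theorem topContent_of_lt_durfee (s : RShape) {j : ℕ} (h : j < durfee s.inner) :
    s.topContent j = s.content 0 0 - leg s.inner j - 1 := by
  have := (lt_durfee_iff_colLen _ _).1 h
  rw [s.topContent_eq, leg]
  omega

theorem topContent_of_durfee_le (s : RShape) {j : ℕ} (h : durfee s.inner ≤ j) :
    s.topContent j = s.content 0 0 + frobeniusFun s.inner j := by
  have := mt (lt_durfee_iff_colLen _ _).2 (not_lt.2 h)
  rw [s.topContent_eq, frobeniusFun, if_neg (not_lt.2 h)]
  omega

theorem botContent_of_lt_durfee (s : RShape) {j : ℕ} (h : j < durfee s.outer) :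
    s.botContent j = s.content 0 0 - leg s.outer j := by
  have := (lt_durfee_iff_colLen _ _).1 h
  rw [s.botContent_eq, leg]
  omega

theorem botContent_of_durfee_le (s : RShape) {j : ℕ} (h : durfee s.outer ≤ j) :
    s.botContent j = s.content 0 0 + frobeniusFun s.outer j + 1 := by
  have := mt (lt_durfee_iff_colLen _ _).2 (not_lt.2 h)
  rw [s.botContent_eq, frobeniusFun, if_neg (not_lt.2 h)]
  omega

/-- The skew Giambelli formula; it does not need the inequalities for column flags. -/
theorem schur_eq_giambelli (s : RShape) (a b : ℕ → ℤ) (y z : ℤ → R) :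
    s.schur a b y z = (-1) ^ durfee s.inner *
      (Matrix.fromBlocks
        (Matrix.of fun i j : Fin (durfee s.outer) => s.hookEntry a b y z i j)
        (Matrix.of fun (i : Fin (durfee s.outer)) (j : Fin (durfee s.inner)) =>
          s.vertEntry a b y z i j)
        (Matrix.of fun (i : Fin (durfee s.inner)) (j : Fin (durfee s.outer)) =>
          s.horizEntry a b y z i j)
        (0 : Matrix (Fin (durfee s.inner)) (Fin (durfee s.inner)) R)).det := by
  have hin := s.inner_rowLen_le 0
  have hk := durfee_le_rowLen s.outer
  have hl := (durfee_le_rowLen s.inner).trans hin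
  set n := s.outer.rowLen 0 with hn
  set g := s.shiftedKernel a b y z with hg
  have g0 : ∀ i j, j < i → g i j = 0 := s.shiftedKernel_of_lt a b y z
  have g1 : ∀ i, g i i = 1 := s.shiftedKernel_self a b y z
  set σ := frobeniusPerm s.outer hn.ge with hσ
  set τ := frobeniusPerm s.inner hin with hτ
  set U : Matrix (Fin n) (Fin n) R := Matrix.of fun x y : Fin n => g x y with hU
  set X : Matrix (Fin n) (Fin n) R := Matrix.of fun t u : Fin n =>
    if (t : ℕ) ≤ u then (-1) ^ ((t : ℕ) + u) * shiftedMinor g t (u - t) else 0 with hX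
  have hUX : U * X = 1 := unitriangular_mul_minors n g g0 g1
  have hdet : U.det = 1 := by
    rw [Matrix.det_of_isUpperTriangular (M := U) (fun i j hij => g0 i j hij)]
    exact Finset.prod_eq_one fun i _ => g1 i
  have hUX' : U.submatrix σ τ * X.submatrix τ σ = 1 := by
    rw [Matrix.submatrix_mul_equiv, hUX, Matrix.submatrix_one_equiv]
  have rp : ∀ {m : ℕ} (h : m ≤ n) (i : Fin n), i ∉ Set.range (Fin.castLE h) → m ≤ (i : ℕ) :=
    fun h i hi => by
      rw [Fin.range_castLE] at hi
      exact not_lt.1 hi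
  -- The replaced rows and columns are the first k and the first ℓ, those meeting the diagonals of
  -- the outer and inner shapes.
  rw [s.schur_eq_det_kernel, det_of_replaced (U.submatrix σ τ) (X.submatrix τ σ) _ hUX'
    (Fin.castLE_injective hk) (Fin.castLE_injective hl)
    (Matrix.of fun (i : Fin (durfee s.outer)) (j : Fin (durfee s.inner)) =>
      s.vertEntry a b y z i j)
    (Matrix.of fun (i : Fin (durfee s.outer)) (x : Fin n) =>
      s.kernel a b y z (s.content 0 0 - leg s.outer i) (s.content 0 0 + (τ x : ℕ)))]
  · have hsub : (U.submatrix σ τ).det = (∏ i : Fin (durfee s.outer), (-1 : R) ^ arm s.outer i) *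
        ∏ i : Fin (durfee s.inner), (-1 : R) ^ arm s.inner i := by
      have : U.submatrix σ τ = (U.submatrix σ id).submatrix id τ := rfl
      rw [this, Matrix.det_permute', Matrix.det_permute, hdet, mul_one, hσ, hτ,
        sign_frobeniusPerm, sign_frobeniusPerm]
      push_cast
      ring
    -- An entry (t, u) of the inverse has sign (-1)^(t + u). The factor from u = u_j scales a
    -- column; the factor from t = c_i scales a strip row, while in a hook row it belongs to the
    -- Hessenberg expansion.
    set v : Fin (durfee s.outer) ⊕ Fin (durfee s.inner) → R :=
      Sum.elim (fun j => (-1) ^ arm s.outer j) (fun _ => 1) with hv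
    set w : Fin (durfee s.outer) ⊕ Fin (durfee s.inner) → R :=
      Sum.elim (fun _ => 1) (fun i => (-1) ^ arm s.inner i) with hw
    set G := Matrix.fromBlocks
        (Matrix.of fun i j : Fin (durfee s.outer) => s.hookEntry a b y z i j)
        (Matrix.of fun (i : Fin (durfee s.outer)) (j : Fin (durfee s.inner)) =>
          s.vertEntry a b y z i j)
        (Matrix.of fun (i : Fin (durfee s.inner)) (j : Fin (durfee s.outer)) =>
          s.horizEntry a b y z i j)
        (0 : Matrix (Fin (durfee s.inner)) (Fin (durfee s.inner)) R) with hG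
    have harm : ∀ j : Fin (durfee s.outer), ((σ (Fin.castLE hk j) : Fin n) : ℕ) = arm s.outer j :=
      fun j => if_pos j.isLt
    have harm' : ∀ j : Fin (durfee s.inner), ((τ (Fin.castLE hl j) : Fin n) : ℕ) = arm s.inner j :=
      fun j => if_pos j.isLt
    have hscale : Matrix.fromBlocks
        ((Matrix.of fun (i : Fin (durfee s.outer)) (x : Fin n) =>
          s.kernel a b y z (s.content 0 0 - leg s.outer i) (s.content 0 0 + (τ x : ℕ))) *
          (X.submatrix τ σ).submatrix id (Fin.castLE hk))
        (Matrix.of fun (i : Fin (durfee s.outer)) (j : Fin (durfee s.inner)) =>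
          s.vertEntry a b y z i j)
        ((X.submatrix τ σ).submatrix (Fin.castLE hl) (Fin.castLE hk)) 0 =
        Matrix.of fun i j => w i * (Matrix.of fun i j => v j * G i j) i j := by
      ext (i | i) (j | j)
      · simp only [Matrix.fromBlocks_apply₁₁, Matrix.of_apply, hw, hv, hG, Sum.elim_inl, one_mul,
          Matrix.mul_apply, Matrix.submatrix_apply, id]
        rw [Equiv.sum_comp τ (fun x : Fin n => s.kernel a b y z (s.content 0 0 - leg s.outer i)
          (s.content 0 0 + (x : ℕ)) * X x (σ (Fin.castLE hk j)))]
        simp only [hX, Matrix.of_apply, harm]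
        rw [Fin.sum_univ_eq_sum_range (fun x => s.kernel a b y z
          (s.content 0 0 - leg s.outer i) (s.content 0 0 + x) * (if x ≤ arm s.outer j then
            (-1) ^ (x + arm s.outer j) * shiftedMinor g x (arm s.outer j - x) else 0)) n,
          s.hookEntry_eq, Finset.mul_sum,
          ← Finset.sum_subset (s₁ := Finset.range (arm s.outer j + 1))]
        · refine Finset.sum_congr rfl fun x hx => ?_
          rw [if_pos (Nat.lt_succ_iff.1 (Finset.mem_range.1 hx)), pow_add]
          ring
        · rw [← harm]
          exact Finset.range_subset_range.2 (Fin.isLt _)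
        · intro x _ hx
          rw [if_neg (fun h => hx (Finset.mem_range.2 (Nat.lt_succ_iff.2 h))), mul_zero]
      · simp [hw, hv, hG]
      · simp only [Matrix.fromBlocks_apply₂₁, Matrix.of_apply, hw, hv, hG, Sum.elim_inl,
          Sum.elim_inr, Matrix.submatrix_apply, hX, harm, harm', s.horizEntry_eq]
        split_ifs
        · rw [pow_add, mul_assoc]
        · rw [mul_zero, mul_zero]
      · simp [hw, hv, hG]
    have hsq : ∀ (m : ℕ) (f : Fin m → ℕ),
        (∏ i, (-1 : R) ^ f i) * ∏ i, (-1 : R) ^ f i = 1 := fun m f => by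
      rw [← Finset.prod_mul_distrib]
      exact Finset.prod_eq_one fun i _ => by rw [← mul_pow]; simp
    rw [hscale, Matrix.det_mul_column, Matrix.det_mul_row, hsub, Fintype.card_fin,
      Fintype.prod_sum_type, Fintype.prod_sum_type]
    simp only [hw, hv, Sum.elim_inl, Sum.elim_inr, Finset.prod_const_one, one_mul, mul_one]
    -- Each product of signs occurs twice, once from a permutation and once from the scaling, and
    -- squares to 1.
    linear_combination ((-1) ^ durfee s.inner * G.det) *
      ((∏ i : Fin (durfee s.outer), (-1 : R) ^ arm s.outer i) *
        (∏ i : Fin (durfee s.outer), (-1 : R) ^ arm s.outer i) *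
        hsq _ (fun i : Fin (durfee s.inner) => arm s.inner i) +
        hsq _ (fun i : Fin (durfee s.outer) => arm s.outer i))
  · intro i j
    rw [Matrix.of_apply, Matrix.of_apply, s.vertEntry_eq, Fin.val_castLE, Fin.val_castLE,
      botContent_of_lt_durfee s i.isLt, topContent_of_lt_durfee s j.isLt]
  · intro i j hj
    rw [Matrix.of_apply, Matrix.of_apply, Fin.val_castLE, botContent_of_lt_durfee s i.isLt,
      topContent_of_durfee_le s (rp _ _ hj)]
    rfl
  -- Here the bottom content is at least κ + 1 and the top content at most κ - 1, so the entry has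
  -- negative degree.
  · intro j i hi
    rw [Matrix.of_apply, botContent_of_durfee_le s (rp _ _ hi), Fin.val_castLE,
      topContent_of_lt_durfee s j.isLt]
    exact RShape.kernel_of_lt _ _ _ _ _ (by omega)
  · intro i hi j hj
    rw [Matrix.of_apply, botContent_of_durfee_le s (rp _ _ hi),
      topContent_of_durfee_le s (rp _ _ hj)]
    rfl

end Giambelli

end FlaggedSchur

theorem mainTheorem6 {R : Type*} [CommRing R] (s : FlaggedSchur.RShape)
    (a b : ℕ → ℤ) (hab : s.IsColumnFlags a b) (y z : ℤ → R) :
    s.schur a b y z =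
      (-1) ^ FlaggedSchur.durfee s.inner *
        (Matrix.fromBlocks
          (Matrix.of fun (i : Fin (FlaggedSchur.durfee s.outer))
              (j : Fin (FlaggedSchur.durfee s.outer)) => s.hookEntry a b y z i j)
          (Matrix.of fun (i : Fin (FlaggedSchur.durfee s.outer))
              (j : Fin (FlaggedSchur.durfee s.inner)) => s.vertEntry a b y z i j)
          (Matrix.of fun (i : Fin (FlaggedSchur.durfee s.inner))
              (j : Fin (FlaggedSchur.durfee s.outer)) => s.horizEntry a b y z i j)
          (0 : Matrix (Fin (FlaggedSchur.durfee s.inner))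
              (Fin (FlaggedSchur.durfee s.inner)) R)).det :=
  FlaggedSchur.schur_eq_giambelli s a b y z
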